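/- **Theorem (The Ghost Lemma).** Let $(\mathcal A;\mathcal E)$ be an exact category: an additive category $\mathcal A$ with a class $\mathcal E$ of kernel-cokernel pairs (conflations $A\to B\to C$, consisting of an inflation and a deflation), closed under isomorphism and satisfying Quillen's axioms. An ideal $\mathcal I$ of $\mathcal A$ is an additive subbifunctor of $\mathrm{Hom}$, and $\langle\mathcal M\rangle$ denotes the smallest ideal containing a class $\mathcal M$ of morphisms. Use the following notions. * An ME-conflation $i\to a\to j$ of morphisms $i:I_0\to I_1$, $a:A_0\to A_1$, $j:J_0\to J_1$ is a morphism $(i,a,j)$ from a conflation $I_0\to A_0\xrightarrow{e_0}J_0$ to a conflation $I_1\xrightarrow{m_1}A_1\to J_1$ which factors through some conflation $I_0\to B\to J_1$ as $(i,a_2,1_{J_1})\circ(1_{I_0},a_1,j)$, with $a=a_2a_1$. It is null-homotopic if $a=m_1h+ge_0$ for some $h:A_0\to I_1$ and $g:J_0\to A_1$. * $\mathcal I\mathcal J=\langle ij \mid i\in\mathcal I,\ j\in\mathcal J \text{ composable}\rangle$ (first $j$, then $i$), and $\mathcal I\diamond\mathcal J=\langle a \mid \text{there is an ME-conflation } i\to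 a\to j \text{ with } i\in\mathcal I,\ j\in\mathcal J\rangle$. * $\mathrm{Ext}(j,i)=0$ means that every ME-conflation $i\to a\to j$ is null-homotopic; $\mathcal I^\perp=\{k\mid \mathrm{Ext}(i,k)=0\ \forall i\in\mathcal I\}$ and ${}^\perp\mathcal J=\{k\mid \mathrm{Ext}(k,j)=0\ \forall j\in\mathcal J\}$. These are ideals. * A special $\mathcal I$-precover of an object $X$ is a morphism $i_1:C_1\to X$ in $\mathcal I$ that is the deflation of a conflation $K_1\to C_1\to X$ obtained from some conflation $K_0\to C_0\to X$ by pushout along a morphism $k:K_0\to K_1$ in $\mathcal I^\perp$. Dually, a special $\mathcal J$-preenvelope of $X$ is a morphism $j_1:X\to C_1$ in $\mathcal J$ that is the inflation of a conflation $X\to C_1\to K_1$ obtained from some conflation $X\to C_0\to K_0$ by pullback along a morphism $k:K_1\to K_0$ in ${}^\perp\mathcal J$. The ideal $\mathcal I$ is special precovering (resp. special preenveloping) if every object has a special $\mathcal I$-precover (resp. special $\mathcal I$-preenvelope). * A morphism is injective (resp. projective) if it belongs to $\mathrm{Hom}^\perp$ (resp. ${}^\perp\mathrm{Hom}$), where $\mathrm{Hom}$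 is the ideal of all morphisms. Assume that $(\mathcal A;\mathcal E)$ has enough injective morphisms (every object $X$ admits an inflation $X\to Y$ that is an injective morphism) and enough projective morphisms (every object $X$ admits a deflation $Y\to X$ that is a projective morphism). Then: 1. if $\mathcal I$ and $\mathcal J$ are special precovering ideals, so are $\mathcal I\mathcal J$ and $\mathcal I\diamond\mathcal J$; 2. if $\mathcal I$ and $\mathcal J$ are special preenveloping ideals, so are $\mathcal I\mathcal J$ and $\mathcal I\diamond\mathcal J$; 3. the rule $\mathcal I\mapsto\mathcal I^\perp$ is a bijective correspondence from the class of special precovering ideals onto the class of special preenveloping ideals, and for all special precovering ideals $\mathcal I,\mathcal J$, $$(\mathcal I\mathcal J)^\perp=\mathcal J^\perp\diamond\mathcal I^\perp\qquad\text{and}\qquad(\mathcal I\diamond\mathcal J)^\perp=\mathcal J^\perp\mathcal I^\perp.$$ -/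

import Mathlib

open CategoryTheory CategoryTheory.Limits

universe v u

/-- An ideal of a preadditive category: an additive subbifunctor of `Hom`. -/
@[ext]
structure MorphismIdeal (A : Type u) [Category.{v} A] [Preadditive A] where
  /-- The subgroup of `Hom (X, Y)` formed by the morphisms `X ⟶ Y` of the ideal. -/
  hom : ∀ X Y : A, AddSubgroup (X ⟶ Y)
  precomp_mem : ∀ {X' X Y : A} (s : X' ⟶ X) {f : X ⟶ Y}, f ∈ hom X Y → s ≫ f ∈ hom X' Y
  postcomp_mem : ∀ {X Y Y' : A} {f : X ⟶ Y} (r : Y ⟶ Y'), f ∈ hom X Y → f ≫ r ∈ hom X Y'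

namespace MorphismIdeal

variable {A : Type u} [Category.{v} A] [Preadditive A]

/-- The class of all morphisms that belong to an ideal. -/
def toProperty (I : MorphismIdeal A) : MorphismProperty A :=
  fun X Y f => f ∈ I.hom X Y

/-- The ideal `Hom` of all morphisms. -/
def homIdeal (A : Type u) [Category.{v} A] [Preadditive A] : MorphismIdeal A where
  hom _ _ := ⊤
  precomp_mem _ _ _ := AddSubgroup.mem_top _
  postcomp_mem _ _ := AddSubgroup.mem_top _

/-- The smallest ideal `⟨M⟩` that contains a class `M` of morphisms: the intersection of all
the ideals that contain it. -/
def span (M : MorphismProperty A) : MorphismIdeal A where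
  hom X Y := ⨅ (I : MorphismIdeal A) (_ : M ≤ I.toProperty), I.hom X Y
  precomp_mem s f hf := by
    simp only [AddSubgroup.mem_iInf] at hf ⊢
    exact fun I hI => I.precomp_mem s (hf I hI)
  postcomp_mem r hf := by
    simp only [AddSubgroup.mem_iInf] at hf ⊢
    exact fun I hI => I.postcomp_mem r (hf I hI)

/-- The product `I J`, generated by the composites `i ∘ j` (first `j`, then `i`) with `i ∈ I`
and `j ∈ J`. -/
instance : Mul (MorphismIdeal A) where
  mul I J := span fun X Z f =>
    ∃ (Y : A) (j : X ⟶ Y) (i : Y ⟶ Z), j ∈ J.hom X Y ∧ i ∈ I.hom Y Z ∧ j ≫ i = f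

end MorphismIdeal

/-- The two maps of `S` form a kernel-cokernel pair. -/
structure IsKernelCokernelPair {A : Type u} [Category.{v} A] [Preadditive A]
    (S : ShortComplex A) : Prop where
  isKernel : Nonempty (IsLimit (KernelFork.ofι S.f S.zero))
  isCokernel : Nonempty (IsColimit (CokernelCofork.ofπ S.g S.zero))

/-- `m` is the first map of a short complex in the class `P`. -/
def IsInflationOf {A : Type u} [Category.{v} A] [Preadditive A]
    (P : ShortComplex A → Prop) {X Y : A} (m : X ⟶ Y) : Prop :=
  ∃ (Z : A) (e : Y ⟶ Z) (w : m ≫ e = 0), P (ShortComplex.mk m e w)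

/-- `e` is the second map of a short complex in the class `P`. -/
def IsDeflationOf {A : Type u} [Category.{v} A] [Preadditive A]
    (P : ShortComplex A → Prop) {Y Z : A} (e : Y ⟶ Z) : Prop :=
  ∃ (X : A) (m : X ⟶ Y) (w : m ≫ e = 0), P (ShortComplex.mk m e w)

/-- An exact structure (in the sense of Quillen) on a category: a class of kernel-cokernel pairs,
called conflations, closed under isomorphism and subject to the axioms
E₀, E₀ᵒᵖ, E₁, E₁ᵒᵖ, E₂, E₂ᵒᵖ. -/
structure ExactStructure (A : Type u) [Category.{v} A] [Preadditive A] where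
  Conflation : ShortComplex A → Prop
  isKernelCokernelPair : ∀ {S : ShortComplex A}, Conflation S → IsKernelCokernelPair S
  of_iso : ∀ {S T : ShortComplex A}, (S ≅ T) → Conflation S → Conflation T
  inflation_id : ∀ X : A, IsInflationOf Conflation (𝟙 X)
  deflation_id : ∀ X : A, IsDeflationOf Conflation (𝟙 X)
  inflation_comp : ∀ {X Y Z : A} (m : X ⟶ Y) (n : Y ⟶ Z),
    IsInflationOf Conflation m → IsInflationOf Conflation n → IsInflationOf Conflation (m ≫ n)
  deflation_comp : ∀ {X Y Z : A} (d : X ⟶ Y) (e : Y ⟶ Z),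
    IsDeflationOf Conflation d → IsDeflationOf Conflation e → IsDeflationOf Conflation (d ≫ e)
  inflation_pushout : ∀ {X Y X' : A} (m : X ⟶ Y) (s : X ⟶ X'), IsInflationOf Conflation m →
    ∃ (Y' : A) (c : Y ⟶ Y') (m' : X' ⟶ Y'), IsPushout m s c m' ∧ IsInflationOf Conflation m'
  deflation_pullback : ∀ {Y Z Z' : A} (e : Y ⟶ Z) (t : Z' ⟶ Z), IsDeflationOf Conflation e →
    ∃ (Y' : A) (e' : Y' ⟶ Z') (c : Y' ⟶ Y), IsPullback e' c t e ∧ IsDeflationOf Conflation e'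

namespace ExactStructure

variable {A : Type u} [Category.{v} A] [Preadditive A] (E : ExactStructure A)

def IsInflation {X Y : A} (m : X ⟶ Y) : Prop := IsInflationOf E.Conflation m

def IsDeflation {Y Z : A} (e : Y ⟶ Z) : Prop := IsDeflationOf E.Conflation e

/-- A mono-epi (ME) conflation `i → a → j` of arrows: a morphism of conflations
```
  I₀ --m₀--> A₀ --e₀--> J₀
  |          |a₁        |j
  I₀ --m---> B  --e---> J₁
  |i         |a₂        |
  I₁ --m₁--> A₁ --e₁--> J₁
```
from the top row to the bottom row, with middle component `a = a₂ ∘ a₁`, that factors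
through a conflation (the middle row) as displayed. -/
structure MEConflation {I₀ I₁ A₀ A₁ J₀ J₁ : A} (i : I₀ ⟶ I₁) (a : A₀ ⟶ A₁) (j : J₀ ⟶ J₁) where
  m₀ : I₀ ⟶ A₀
  e₀ : A₀ ⟶ J₀
  m₁ : I₁ ⟶ A₁
  e₁ : A₁ ⟶ J₁
  B : A
  m : I₀ ⟶ B
  e : B ⟶ J₁
  a₁ : A₀ ⟶ B
  a₂ : B ⟶ A₁
  zero₀ : m₀ ≫ e₀ = 0
  zero₁ : m₁ ≫ e₁ = 0
  zero : m ≫ e = 0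
  conflation₀ : E.Conflation (ShortComplex.mk m₀ e₀ zero₀)
  conflation₁ : E.Conflation (ShortComplex.mk m₁ e₁ zero₁)
  conflation : E.Conflation (ShortComplex.mk m e zero)
  m₀_a₁ : m₀ ≫ a₁ = m
  a₁_e : a₁ ≫ e = e₀ ≫ j
  m_a₂ : m ≫ a₂ = i ≫ m₁
  a₂_e₁ : a₂ ≫ e₁ = e
  a₁_a₂ : a₁ ≫ a₂ = a

/-- The class `M ⋆ N` of the arrows `a` that are extensions of `j` by `i`, that is, the middle
term of an ME-conflation `i → a → j`, with `i ∈ M` and `j ∈ N`. -/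
def star (M N : MorphismProperty A) : MorphismProperty A := fun _ _ a =>
  ∃ (I₀ I₁ J₀ J₁ : A) (i : I₀ ⟶ I₁) (j : J₀ ⟶ J₁),
    M i ∧ N j ∧ Nonempty (E.MEConflation i a j)

/-- The extension ideal `I ◇ J = ⟨I ⋆ J⟩` of `J` by `I`. -/
def extIdeal (I J : MorphismIdeal A) : MorphismIdeal A :=
  MorphismIdeal.span (E.star I.toProperty J.toProperty)

/-- `Ext(j, i) = 0`: every ME-conflation `i → a → j` is null-homotopic. -/
def ExtOrthogonal {J₀ J₁ I₀ I₁ : A} (j : J₀ ⟶ J₁) (i : I₀ ⟶ I₁) : Prop :=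
  ∀ (A₀ A₁ : A) (a : A₀ ⟶ A₁) (ξ : E.MEConflation i a j),
    ∃ (h : A₀ ⟶ I₁) (g : J₀ ⟶ A₁), a = h ≫ ξ.m₁ + ξ.e₀ ≫ g

/-! Helper facts: the Ext-perpendicular classes of an ideal are ideals. -/

section helpers

variable {E}

lemma Conflation.mono {X Y Z : A} {m : X ⟶ Y} {e : Y ⟶ Z} {w : m ≫ e = 0}
    (h : E.Conflation (ShortComplex.mk m e w)) : Mono m := by
  obtain ⟨l⟩ := (E.isKernelCokernelPair h).isKernel
  exact mono_of_isLimit_fork l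

lemma Conflation.epi {X Y Z : A} {m : X ⟶ Y} {e : Y ⟶ Z} {w : m ≫ e = 0}
    (h : E.Conflation (ShortComplex.mk m e w)) : Epi e := by
  obtain ⟨l⟩ := (E.isKernelCokernelPair h).isCokernel
  exact epi_of_isColimit_cofork l

lemma Conflation.exists_desc {X Y Z : A} {m : X ⟶ Y} {e : Y ⟶ Z} {w : m ≫ e = 0}
    (h : E.Conflation (ShortComplex.mk m e w)) {T : A} (t : Y ⟶ T) (ht : m ≫ t = 0) :
    ∃ u : Z ⟶ T, e ≫ u = t := by
  obtain ⟨l⟩ := (E.isKernelCokernelPair h).isCokernel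
  obtain ⟨u, hu⟩ := CokernelCofork.IsColimit.desc' l t ht
  exact ⟨u, hu⟩

lemma Conflation.exists_lift {X Y Z : A} {m : X ⟶ Y} {e : Y ⟶ Z} {w : m ≫ e = 0}
    (h : E.Conflation (ShortComplex.mk m e w)) {T : A} (t : T ⟶ Y) (ht : t ≫ e = 0) :
    ∃ u : T ⟶ X, u ≫ m = t := by
  obtain ⟨l⟩ := (E.isKernelCokernelPair h).isKernel
  obtain ⟨u, hu⟩ := KernelFork.IsLimit.lift' l t ht
  exact ⟨u, hu⟩

/-- The pushout of a conflation along a morphism from its left term. -/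
lemma Conflation.exists_pushout {X Y Z X' : A} {m : X ⟶ Y} {e : Y ⟶ Z} {w : m ≫ e = 0}
    (h : E.Conflation (ShortComplex.mk m e w)) (s : X ⟶ X') :
    ∃ (Y' : A) (c : Y ⟶ Y') (m' : X' ⟶ Y') (e' : Y' ⟶ Z) (w' : m' ≫ e' = 0),
      IsPushout m s c m' ∧ c ≫ e' = e ∧ E.Conflation (ShortComplex.mk m' e' w') := by
  obtain ⟨Y', c, m', hp, Q, q, wq, hq⟩ := E.inflation_pushout m s ⟨Z, e, w, h⟩
  have hw : m ≫ e = s ≫ (0 : X' ⟶ Z) := by simp [w]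
  have h1 : c ≫ hp.desc e 0 hw = e := hp.inl_desc _ _ _
  have h2 : m' ≫ hp.desc e 0 hw = 0 := hp.inr_desc _ _ _
  generalize hp.desc e 0 hw = e' at h1 h2
  have := Conflation.epi h
  have := Conflation.epi hq
  obtain ⟨u, hu⟩ := Conflation.exists_desc hq e' h2
  obtain ⟨t, ht⟩ := Conflation.exists_desc h (c ≫ q) (by
    rw [← Category.assoc, hp.w, Category.assoc, wq, comp_zero])
  have he't : e' ≫ t = q := hp.hom_ext (by rw [← Category.assoc, h1, ht])
    (by rw [← Category.assoc, h2, wq, zero_comp])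
  let φ : Q ≅ Z :=
    { hom := u
      inv := t
      hom_inv_id := by rw [← cancel_epi q, ← Category.assoc, hu, he't, Category.comp_id]
      inv_hom_id := by
        rw [← cancel_epi e, ← Category.assoc, ht, Category.assoc, hu, h1, Category.comp_id] }
  exact ⟨Y', c, m', e', h2, hp, h1, E.of_iso (S := ShortComplex.mk m' q wq)
    (ShortComplex.isoMk (Iso.refl _) (Iso.refl _) φ (by simp) (by simp [φ, hu])) hq⟩

/-- The pullback of a conflation along a morphism to its right term. -/
lemma Conflation.exists_pullback {X Y Z Z' : A} {m : X ⟶ Y} {e : Y ⟶ Z} {w : m ≫ e = 0}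
    (h : E.Conflation (ShortComplex.mk m e w)) (t : Z' ⟶ Z) :
    ∃ (Y' : A) (m' : X ⟶ Y') (e' : Y' ⟶ Z') (c : Y' ⟶ Y) (w' : m' ≫ e' = 0),
      IsPullback e' c t e ∧ m' ≫ c = m ∧ E.Conflation (ShortComplex.mk m' e' w') := by
  obtain ⟨Y', e', c, hp, K, k, wk, hk⟩ := E.deflation_pullback e t ⟨X, m, w, h⟩
  have hw : (0 : X ⟶ Z') ≫ t = m ≫ e := by simp [w]
  have h1 : hp.lift 0 m hw ≫ c = m := hp.lift_snd _ _ _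
  have h2 : hp.lift 0 m hw ≫ e' = 0 := hp.lift_fst _ _ _
  generalize hp.lift 0 m hw = m' at h1 h2
  have := Conflation.mono h
  have := Conflation.mono hk
  obtain ⟨a, ha⟩ := Conflation.exists_lift hk m' h2
  obtain ⟨b, hb⟩ := Conflation.exists_lift h (k ≫ c) (by
    rw [Category.assoc, ← hp.w, ← Category.assoc, wk, zero_comp])
  have hbm : b ≫ m' = k := hp.hom_ext (by rw [Category.assoc, h2, wk, comp_zero])
    (by rw [Category.assoc, h1, hb])
  let φ : K ≅ X :=
    { hom := b
      inv := a
      hom_inv_id := by rw [← cancel_mono k, Category.assoc, ha, hbm, Category.id_comp]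
      inv_hom_id := by
        rw [← cancel_mono m, Category.assoc, hb, ← Category.assoc, ha, h1, Category.id_comp] }
  exact ⟨Y', m', e', c, h2, hp, h1, E.of_iso (S := ShortComplex.mk k e' wk)
    (ShortComplex.isoMk φ (Iso.refl _) (Iso.refl _) (by simp [φ, hbm]) (by simp)) hk⟩

lemma extOrthogonal_iff_factor_left {J₀ J₁ I₀ I₁ : A} (j : J₀ ⟶ J₁) (i : I₀ ⟶ I₁) :
    E.ExtOrthogonal j i ↔ ∀ (A₀ B : A) (m₀ : I₀ ⟶ A₀) (e₀ : A₀ ⟶ J₀) (m : I₀ ⟶ B) (e : B ⟶ J₁)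
      (w₀ : m₀ ≫ e₀ = 0) (w : m ≫ e = 0) (a₁ : A₀ ⟶ B),
      E.Conflation (ShortComplex.mk m₀ e₀ w₀) → E.Conflation (ShortComplex.mk m e w) →
      m₀ ≫ a₁ = m → a₁ ≫ e = e₀ ≫ j → ∃ h : A₀ ⟶ I₁, m₀ ≫ h = i := by
  constructor
  · intro H A₀ B m₀ e₀ m e w₀ w a₁ h₀ h hm he
    obtain ⟨A₁, a₂, m₁, e₁, w₁, hp, hc, h₁⟩ := Conflation.exists_pushout h i
    obtain ⟨k, g, hkg⟩ := H A₀ A₁ (a₁ ≫ a₂)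
      ⟨m₀, e₀, m₁, e₁, B, m, e, a₁, a₂, w₀, w₁, w, h₀, h₁, h, hm, he, hp.w, hc, rfl⟩
    refine ⟨k, ?_⟩
    have := Conflation.mono h₁
    have hx := congrArg (fun x => m₀ ≫ x) hkg
    simp only [Preadditive.comp_add] at hx
    rw [← Category.assoc, hm, hp.w, ← Category.assoc m₀ e₀, w₀, zero_comp, add_zero,
      ← Category.assoc] at hx
    exact ((cancel_mono m₁).1 hx).symm
  · intro H A₀ A₁ a ξ
    obtain ⟨k, hk⟩ := H _ _ _ _ _ _ ξ.zero₀ ξ.zero ξ.a₁ ξ.conflation₀ ξ.conflation ξ.m₀_a₁ ξ.a₁_e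
    have hx : ξ.m₀ ≫ a = i ≫ ξ.m₁ := (congrArg (fun x => ξ.m₀ ≫ x) ξ.a₁_a₂).symm.trans (by
      rw [← Category.assoc, ξ.m₀_a₁, ξ.m_a₂])
    obtain ⟨g, hg⟩ := Conflation.exists_desc ξ.conflation₀ (a - k ≫ ξ.m₁) (by
      rw [Preadditive.comp_sub, hx, ← Category.assoc, hk, sub_self])
    exact ⟨k, g, by rw [hg]; abel⟩

lemma extOrthogonal_iff_factor_right {J₀ J₁ I₀ I₁ : A} (j : J₀ ⟶ J₁) (i : I₀ ⟶ I₁) :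
    E.ExtOrthogonal j i ↔ ∀ (A₁ B : A) (m₁ : I₁ ⟶ A₁) (e₁ : A₁ ⟶ J₁) (m : I₀ ⟶ B) (e : B ⟶ J₁)
      (w₁ : m₁ ≫ e₁ = 0) (w : m ≫ e = 0) (a₂ : B ⟶ A₁),
      E.Conflation (ShortComplex.mk m₁ e₁ w₁) → E.Conflation (ShortComplex.mk m e w) →
      m ≫ a₂ = i ≫ m₁ → a₂ ≫ e₁ = e → ∃ g : J₀ ⟶ A₁, g ≫ e₁ = j := by
  constructor
  · intro H A₁ B m₁ e₁ m e w₁ w a₂ h₁ h hm he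
    obtain ⟨A₀, m₀, e₀, a₁, w₀, hp, hc, h₀⟩ := Conflation.exists_pullback h j
    obtain ⟨k, g, hkg⟩ := H A₀ A₁ (a₁ ≫ a₂)
      ⟨m₀, e₀, m₁, e₁, B, m, e, a₁, a₂, w₀, w₁, w, h₀, h₁, h, hc, hp.w.symm, hm, he, rfl⟩
    refine ⟨g, ?_⟩
    have := Conflation.epi h₀
    have hx := congrArg (fun x => x ≫ e₁) hkg
    simp only [Preadditive.add_comp] at hx
    rw [Category.assoc, he, ← hp.w, Category.assoc k, w₁, comp_zero, zero_add,
      Category.assoc] at hx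
    exact ((cancel_epi e₀).1 hx).symm
  · intro H A₀ A₁ a ξ
    obtain ⟨g, hg⟩ := H _ _ _ _ _ _ ξ.zero₁ ξ.zero ξ.a₂ ξ.conflation₁ ξ.conflation ξ.m_a₂ ξ.a₂_e₁
    have hx : a ≫ ξ.e₁ = ξ.e₀ ≫ j := (congrArg (fun x => x ≫ ξ.e₁) ξ.a₁_a₂).symm.trans (by
      rw [Category.assoc, ξ.a₂_e₁, ξ.a₁_e])
    obtain ⟨k, hk⟩ := Conflation.exists_lift ξ.conflation₁ (a - ξ.e₀ ≫ g) (by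
      rw [Preadditive.sub_comp, hx, Category.assoc, hg, sub_self])
    exact ⟨k, g, by rw [hk]; abel⟩

lemma ExtOrthogonal.precomp_right {J₀ J₁ I I₀ I₁ : A} {j : J₀ ⟶ J₁} {i : I₀ ⟶ I₁}
    (H : E.ExtOrthogonal j i) (s : I ⟶ I₀) : E.ExtOrthogonal j (s ≫ i) := by
  rw [extOrthogonal_iff_factor_left] at H ⊢
  intro A₀ B m₀ e₀ m e w₀ w a₁ h₀ h hm he
  obtain ⟨A₀', c₀, m₀', e₀', w₀', hp₀, hc₀, h₀'⟩ := Conflation.exists_pushout h₀ s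
  obtain ⟨B', c, m', e', w', hp, hc, h'⟩ := Conflation.exists_pushout h s
  have hw : m₀ ≫ a₁ ≫ c = s ≫ m' := by rw [← Category.assoc, hm, hp.w]
  obtain ⟨k, hk⟩ := H A₀' B' m₀' e₀' m' e' w₀' w' (hp₀.desc (a₁ ≫ c) m' hw) h₀' h'
    (hp₀.inr_desc _ _ _) (hp₀.hom_ext
      (by rw [← Category.assoc, hp₀.inl_desc, Category.assoc, hc, he, ← Category.assoc, hc₀])
      (by rw [← Category.assoc, hp₀.inr_desc, w', ← Category.assoc, w₀', zero_comp]))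
  exact ⟨c₀ ≫ k, by rw [← Category.assoc, hp₀.w, Category.assoc, hk]⟩

lemma ExtOrthogonal.postcomp_left {J₀ J₁ J I₀ I₁ : A} {j : J₀ ⟶ J₁} {i : I₀ ⟶ I₁}
    (H : E.ExtOrthogonal j i) (r : J₁ ⟶ J) : E.ExtOrthogonal (j ≫ r) i := by
  rw [extOrthogonal_iff_factor_right] at H ⊢
  intro A₁ B m₁ e₁ m e w₁ w a₂ h₁ h hm he
  obtain ⟨A₁', m₁', e₁', c₁, w₁', hp₁, hc₁, h₁'⟩ := Conflation.exists_pullback h₁ r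
  obtain ⟨B', m', e', c, w', hp, hc, h'⟩ := Conflation.exists_pullback h r
  have hw : e' ≫ r = (c ≫ a₂) ≫ e₁ := by rw [Category.assoc, he, hp.w]
  obtain ⟨k, hk⟩ := H A₁' B' m₁' e₁' m' e' w₁' w' (hp₁.lift e' (c ≫ a₂) hw) h₁' h'
    (hp₁.hom_ext
      (by rw [Category.assoc, hp₁.lift_fst, w', Category.assoc, w₁', comp_zero])
      (by rw [Category.assoc, hp₁.lift_snd, ← Category.assoc, hc, hm, Category.assoc, hc₁]))
    (hp₁.lift_fst _ _ _)
  exact ⟨k ≫ c₁, by rw [Category.assoc, ← hp₁.w, ← Category.assoc, hk]⟩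

end helpers

/-- The right Ext-perpendicular ideal `I^⊥ = {j | Ext(i, j) = 0 for all i ∈ I}`. -/
def rightPerp (I : MorphismIdeal A) : MorphismIdeal A where
  hom X Y :=
    { carrier := {j | ∀ (X' Y' : A) (i : X' ⟶ Y'), i ∈ I.hom X' Y' → E.ExtOrthogonal i j}
      zero_mem' := fun X' Y' i _ => by
        rw [extOrthogonal_iff_factor_left]
        intros
        exact ⟨0, comp_zero⟩
      add_mem' := fun {a b} ha hb X' Y' i hi => by
        have ha' := ha X' Y' i hi
        have hb' := hb X' Y' i hi
        rw [extOrthogonal_iff_factor_left] at ha' hb' ⊢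
        intro A₀ B m₀ e₀ m e w₀ w a₁ h₀ h hm he
        obtain ⟨k, hk⟩ := ha' A₀ B m₀ e₀ m e w₀ w a₁ h₀ h hm he
        obtain ⟨l, hl⟩ := hb' A₀ B m₀ e₀ m e w₀ w a₁ h₀ h hm he
        exact ⟨k + l, by rw [Preadditive.comp_add, hk, hl]⟩
      neg_mem' := fun {a} ha X' Y' i hi => by
        have ha' := ha X' Y' i hi
        rw [extOrthogonal_iff_factor_left] at ha' ⊢
        intro A₀ B m₀ e₀ m e w₀ w a₁ h₀ h hm he
        obtain ⟨k, hk⟩ := ha' A₀ B m₀ e₀ m e w₀ w a₁ h₀ h hm he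
        exact ⟨-k, by rw [Preadditive.comp_neg, hk]⟩ }
  precomp_mem s _ hf X' Y' i hi := (hf X' Y' i hi).precomp_right s
  postcomp_mem r hf X' Y' i hi := by
    have hf' := hf X' Y' i hi
    rw [extOrthogonal_iff_factor_left] at hf' ⊢
    intro A₀ B m₀ e₀ m e w₀ w a₁ h₀ h hm he
    obtain ⟨k, hk⟩ := hf' A₀ B m₀ e₀ m e w₀ w a₁ h₀ h hm he
    exact ⟨k ≫ r, by rw [← Category.assoc, hk]⟩

/-- The left Ext-perpendicular ideal `^⊥J = {i | Ext(i, j) = 0 for all j ∈ J}`. -/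
def leftPerp (J : MorphismIdeal A) : MorphismIdeal A where
  hom X Y :=
    { carrier := {i | ∀ (X' Y' : A) (j : X' ⟶ Y'), j ∈ J.hom X' Y' → E.ExtOrthogonal i j}
      zero_mem' := fun X' Y' j _ => by
        rw [extOrthogonal_iff_factor_right]
        intros
        exact ⟨0, zero_comp⟩
      add_mem' := fun {a b} ha hb X' Y' j hj => by
        have ha' := ha X' Y' j hj
        have hb' := hb X' Y' j hj
        rw [extOrthogonal_iff_factor_right] at ha' hb' ⊢
        intro A₁ B m₁ e₁ m e w₁ w a₂ h₁ h hm he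
        obtain ⟨k, hk⟩ := ha' A₁ B m₁ e₁ m e w₁ w a₂ h₁ h hm he
        obtain ⟨l, hl⟩ := hb' A₁ B m₁ e₁ m e w₁ w a₂ h₁ h hm he
        exact ⟨k + l, by rw [Preadditive.add_comp, hk, hl]⟩
      neg_mem' := fun {a} ha X' Y' j hj => by
        have ha' := ha X' Y' j hj
        rw [extOrthogonal_iff_factor_right] at ha' ⊢
        intro A₁ B m₁ e₁ m e w₁ w a₂ h₁ h hm he
        obtain ⟨k, hk⟩ := ha' A₁ B m₁ e₁ m e w₁ w a₂ h₁ h hm he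
        exact ⟨-k, by rw [Preadditive.neg_comp, hk]⟩ }
  precomp_mem s _ hf X' Y' j hj := by
    have hf' := hf X' Y' j hj
    rw [extOrthogonal_iff_factor_right] at hf' ⊢
    intro A₁ B m₁ e₁ m e w₁ w a₂ h₁ h hm he
    obtain ⟨k, hk⟩ := hf' A₁ B m₁ e₁ m e w₁ w a₂ h₁ h hm he
    exact ⟨s ≫ k, by rw [Category.assoc, hk]⟩
  postcomp_mem r hf X' Y' j hj := (hf X' Y' j hj).postcomp_left r

/-- `f` is an injective morphism: it lies in `Hom^⊥`. -/
def IsInjectiveMorphism {X Y : A} (f : X ⟶ Y) : Prop :=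
  f ∈ (E.rightPerp (MorphismIdeal.homIdeal A)).hom X Y

/-- `f` is a projective morphism: it lies in `^⊥Hom`. -/
def IsProjectiveMorphism {X Y : A} (f : X ⟶ Y) : Prop :=
  f ∈ (E.leftPerp (MorphismIdeal.homIdeal A)).hom X Y

/-- Every object is the domain of an injective inflation. -/
def HasEnoughInjectiveMorphisms : Prop :=
  ∀ X : A, ∃ (Y : A) (e : X ⟶ Y), E.IsInflation e ∧ E.IsInjectiveMorphism e

/-- Every object is the codomain of a projective deflation. -/
def HasEnoughProjectiveMorphisms : Prop :=
  ∀ X : A, ∃ (Y : A) (p : Y ⟶ X), E.IsDeflation p ∧ E.IsProjectiveMorphism p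

/-- `i₁ : C₁ ⟶ X` is a special `I`-precover of `X`: it lies in `I` and is the deflation of the
pushout `K₁ → C₁ → X` of some conflation `K₀ → C₀ → X` along a morphism `k : K₀ ⟶ K₁` in `I^⊥`. -/
def IsSpecialPrecover (I : MorphismIdeal A) {C₁ X : A} (i₁ : C₁ ⟶ X) : Prop :=
  i₁ ∈ I.hom C₁ X ∧
  ∃ (K₀ K₁ C₀ : A) (k : K₀ ⟶ K₁) (c : C₀ ⟶ C₁) (m₀ : K₀ ⟶ C₀) (i₀ : C₀ ⟶ X) (m₁ : K₁ ⟶ C₁)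
    (w₀ : m₀ ≫ i₀ = 0) (w₁ : m₁ ≫ i₁ = 0),
    E.Conflation (ShortComplex.mk m₀ i₀ w₀) ∧ E.Conflation (ShortComplex.mk m₁ i₁ w₁) ∧
    IsPushout m₀ k c m₁ ∧ c ≫ i₁ = i₀ ∧ k ∈ (E.rightPerp I).hom K₀ K₁

/-- `j₁ : X ⟶ C₁` is a special `J`-preenvelope of `X`: it lies in `J` and is the inflation of the
pullback `X → C₁ → K₁` of some conflation `X → C₀ → K₀` along a morphism `k : K₁ ⟶ K₀` in
`^⊥J`. -/
def IsSpecialPreenvelope (J : MorphismIdeal A) {X C₁ : A} (j₁ : X ⟶ C₁) : Prop :=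
  j₁ ∈ J.hom X C₁ ∧
  ∃ (K₀ K₁ C₀ : A) (k : K₁ ⟶ K₀) (c : C₁ ⟶ C₀) (j₀ : X ⟶ C₀) (e₀ : C₀ ⟶ K₀) (e₁ : C₁ ⟶ K₁)
    (w₀ : j₀ ≫ e₀ = 0) (w₁ : j₁ ≫ e₁ = 0),
    E.Conflation (ShortComplex.mk j₀ e₀ w₀) ∧ E.Conflation (ShortComplex.mk j₁ e₁ w₁) ∧
    IsPullback e₁ c k e₀ ∧ j₁ ≫ c = j₀ ∧ k ∈ (E.leftPerp J).hom K₁ K₀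

/-- Every object has a special `I`-precover. -/
def IsSpecialPrecovering (I : MorphismIdeal A) : Prop :=
  ∀ X : A, ∃ (C : A) (i : C ⟶ X), E.IsSpecialPrecover I i

/-- Every object has a special `J`-preenvelope. -/
def IsSpecialPreenveloping (J : MorphismIdeal A) : Prop :=
  ∀ X : A, ∃ (C : A) (j : X ⟶ C), E.IsSpecialPreenvelope J j

end ExactStructure

/-! A morphism of conflations `ξ → ξ'` with end components `f` and `g` witnesses `f_* ξ = g^* ξ'` in
`Ext`. The inclusion `J^⊥ ◇ I^⊥ ≤ (I J)^⊥` follows from the exactness of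
`Ext(-, L) → Ext(-, B) → Ext(-, P)` for a conflation `L → B → P`.

For the converse, let `f` be in `(I J)^⊥` with domain `X`, embed `X` by an injective inflation with
cokernel `Z`, and pull the resulting conflation `ξ` back along a special `I`-precover `C → Z` to a
conflation `ζ`. By Salce's Lemma the inflation of `ζ` lies in `I^⊥`. Let `C' → C` be a special
`J`-precover, with conflation `η₁ = l_* η₀` for some `l` in `J^⊥`. The composite `C' → C → Z` lies
in `I J`, so `f_* ξ` vanishes along it. Hence `f_* ζ` vanishes along `C' → C`, that is,
`f_* ζ = a_* η₁ = (l ≫ a)_* η₀` for some `a`, and this presents `f` as an element of `J^⊥ ◇ I^⊥`.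

By the resulting formula for `(I J)^⊥`, the composite of two special precovers is a special
precover. Everything else follows by duality, since the maps `I ↦ I^⊥` and `K ↦ ^⊥K` are mutually
inverse between special precovering and special preenveloping ideals. -/

namespace MorphismIdeal

variable {A : Type u} [Category.{v} A] [Preadditive A] {I J : MorphismIdeal A}

lemma toProperty_injective : Function.Injective (toProperty (A := A)) := by
  intro I J h
  ext X Y f
  exact iff_of_eq (congr_fun₃ h X Y f)

instance : PartialOrder (MorphismIdeal A) :=
  PartialOrder.lift toProperty toProperty_injective

lemma le_toProperty_span (M : MorphismProperty A) : M ≤ (span M).toProperty := by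
  intro X Y f hf
  simp only [toProperty, span, AddSubgroup.mem_iInf]
  exact fun I hI => hI f hf

lemma span_le {M : MorphismProperty A} : span M ≤ I ↔ M ≤ I.toProperty := by
  refine ⟨(le_toProperty_span M).trans, fun h X Y f hf => ?_⟩
  simp only [toProperty, span, AddSubgroup.mem_iInf] at hf
  exact hf I h

lemma comp_mem_mul {X Y Z : A} {j : X ⟶ Y} {i : Y ⟶ Z} (hj : j ∈ J.hom X Y)
    (hi : i ∈ I.hom Y Z) : j ≫ i ∈ (I * J).hom X Z :=
  le_toProperty_span _ _ ⟨Y, j, i, hj, hi, rfl⟩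

end MorphismIdeal

namespace ExactStructure

variable {A : Type u} [Category.{v} A] [Preadditive A] {E : ExactStructure A}

/-- A conflation `X → obj → Z`, regarded as representing an element of `Ext(Z, X)`. -/
structure Extension (E : ExactStructure A) (Z X : A) where
  /-- The middle term of the conflation. -/
  obj : A
  /-- The inflation. -/
  ι : X ⟶ obj
  /-- The deflation. -/
  π : obj ⟶ Z
  zero : ι ≫ π = 0
  conflation : E.Conflation (ShortComplex.mk ι π zero)

namespace Extension

variable {X X' X'' Y Z Z' Z'' : A}

instance (ξ : E.Extension Z X) : Mono ξ.ι := ξ.conflation.mono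

instance (ξ : E.Extension Z X) : Epi ξ.π := ξ.conflation.epi

/-- A morphism of conflations with prescribed end components `f` and `g`. Its existence says that
the pushout of `ξ` along `f` and the pullback of `ξ'` along `g` are equivalent, i.e. that
`f_* ξ = g^* ξ'` in `Ext(Z, X')`. -/
structure Hom (ξ : E.Extension Z X) (ξ' : E.Extension Z' X') (f : X ⟶ X') (g : Z ⟶ Z') where
  /-- The component between the middle terms. -/
  mid : ξ.obj ⟶ ξ'.obj
  ι_mid : ξ.ι ≫ mid = f ≫ ξ'.ι
  mid_π : mid ≫ ξ'.π = ξ.π ≫ g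

variable {ξ : E.Extension Z X} {ξ' : E.Extension Z' X'} {ξ'' : E.Extension Z'' X''}
  {f : X ⟶ X'} {f' : X' ⟶ X''} {g : Z ⟶ Z'} {g' : Z' ⟶ Z''}

/-- The composite of two morphisms of conflations. The composites of the end components may be
given in any propositionally equal form, such as `f` for `𝟙 X ≫ f`. -/
def Hom.comp (u : Hom ξ ξ' f g) (v : Hom ξ' ξ'' f' g') {f'' : X ⟶ X''} {g'' : Z ⟶ Z''}
    (hf : f ≫ f' = f'' := by simp) (hg : g ≫ g' = g'' := by simp) : Hom ξ ξ'' f'' g'' where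
  mid := u.mid ≫ v.mid
  ι_mid := by rw [← hf, reassoc_of% u.ι_mid, v.ι_mid, Category.assoc]
  mid_π := by rw [← hg, Category.assoc, v.mid_π, reassoc_of% u.mid_π]

lemma exists_hom_mid_eq_of_ι_comp {c : ξ.obj ⟶ ξ'.obj} (hc : ξ.ι ≫ c = f ≫ ξ'.ι) :
    ∃ (g : Z ⟶ Z') (u : Hom ξ ξ' f g), u.mid = c := by
  obtain ⟨g, hg⟩ := ξ.conflation.exists_desc (c ≫ ξ'.π) (by
    rw [reassoc_of% hc, ξ'.zero, comp_zero])
  exact ⟨g, ⟨c, hc, hg.symm⟩, rfl⟩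

lemma exists_hom_mid_eq_of_comp_π {c : ξ.obj ⟶ ξ'.obj} (hc : c ≫ ξ'.π = ξ.π ≫ g) :
    ∃ (f : X ⟶ X') (u : Hom ξ ξ' f g), u.mid = c := by
  obtain ⟨f, hf⟩ := ξ'.conflation.exists_lift (ξ.ι ≫ c) (by
    rw [Category.assoc, hc, reassoc_of% ξ.zero, zero_comp])
  exact ⟨f, ⟨c, hf.symm, hc⟩, rfl⟩

lemma exists_isPushout (ξ : E.Extension Z X) (f : X ⟶ X') :
    ∃ (ξ' : E.Extension Z X') (u : Hom ξ ξ' f (𝟙 Z)), IsPushout ξ.ι f u.mid ξ'.ι := by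
  obtain ⟨R, c, m, e, w, hp, hc, h⟩ := ξ.conflation.exists_pushout f
  exact ⟨⟨R, m, e, w, h⟩, ⟨c, hp.w, by rw [hc, Category.comp_id]⟩, hp⟩

lemma exists_isPullback (ξ : E.Extension Z' X) (g : Z ⟶ Z') :
    ∃ (ξ' : E.Extension Z X) (u : Hom ξ' ξ (𝟙 X) g), IsPullback ξ'.π u.mid g ξ.π := by
  obtain ⟨R, m, e, c, w, hp, hc, h⟩ := ξ.conflation.exists_pullback g
  exact ⟨⟨R, m, e, w, h⟩, ⟨c, by rw [hc, Category.id_comp], hp.w.symm⟩, hp⟩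

/-- The universal property of the pullback `ξ` of `ξ'` along `g`: a morphism into `ξ'` whose right
component factors through `g` factors through `ξ`. -/
noncomputable def Hom.lift {W : A} {ξ : E.Extension Z X} {ξ' : E.Extension Z' X}
    {ζ : E.Extension W Y} {f : Y ⟶ X} {h : W ⟶ Z} (v : Hom ζ ξ' f (h ≫ g))
    (u : Hom ξ ξ' (𝟙 X) g) (hu : IsPullback ξ.π u.mid g ξ'.π) : Hom ζ ξ f h where
  mid := hu.lift (ζ.π ≫ h) v.mid (by rw [Category.assoc, v.mid_π])
  ι_mid := hu.hom_ext
    (by rw [Category.assoc, hu.lift_fst, reassoc_of% ζ.zero, Category.assoc, ξ.zero, zero_comp,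
      comp_zero])
    (by rw [Category.assoc, hu.lift_snd, v.ι_mid, Category.assoc, u.ι_mid, Category.id_comp])
  mid_π := hu.lift_fst _ _ _

/-- Both sides say that the morphism of conflations is null-homotopic. -/
lemma Hom.exists_ι_comp_eq_iff_exists_comp_π_eq (u : Hom ξ ξ' f g) :
    (∃ h : ξ.obj ⟶ X', ξ.ι ≫ h = f) ↔ ∃ s : Z ⟶ ξ'.obj, s ≫ ξ'.π = g := by
  constructor
  · rintro ⟨h, hh⟩
    obtain ⟨s, hs⟩ := ξ.conflation.exists_desc (u.mid - h ≫ ξ'.ι) (by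
      rw [Preadditive.comp_sub, u.ι_mid, reassoc_of% hh, sub_self])
    refine ⟨s, ?_⟩
    rw [← cancel_epi ξ.π, reassoc_of% hs, Preadditive.sub_comp, u.mid_π, Category.assoc, ξ'.zero,
      comp_zero, sub_zero]
  · rintro ⟨s, hs⟩
    obtain ⟨h, hh⟩ := ξ'.conflation.exists_lift (u.mid - ξ.π ≫ s) (by
      rw [Preadditive.sub_comp, u.mid_π, Category.assoc, hs, sub_self])
    refine ⟨h, ?_⟩
    rw [← cancel_mono ξ'.ι, Category.assoc, hh, Preadditive.comp_sub, u.ι_mid,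
      reassoc_of% ξ.zero, zero_comp, sub_zero]

/-- Exactness of `Ext(Y, L) → Ext(Y, κ.obj) → Ext(Y, P)` at the middle term. -/
lemma exists_hom_of_ι_comp_eq_π {L P : A} (κ : E.Extension P L) (ξ : E.Extension Y κ.obj)
    {ρ : ξ.obj ⟶ P} (hρ : ξ.ι ≫ ρ = κ.π) :
    ∃ ζ : E.Extension Y L, Nonempty (Hom ζ ξ κ.ι (𝟙 Y)) := by
  obtain ⟨V, d, wd, hd⟩ := E.inflation_comp κ.ι ξ.ι ⟨_, _, _, κ.conflation⟩ ⟨_, _, _, ξ.conflation⟩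
  let δ : E.Extension V L := ⟨ξ.obj, κ.ι ≫ ξ.ι, d, wd, hd⟩
  obtain ⟨t, a, ha⟩ := exists_hom_mid_eq_of_ι_comp (ξ := κ) (ξ' := δ) (c := ξ.ι)
    (Category.id_comp _).symm
  obtain ⟨q, b, hb⟩ := exists_hom_mid_eq_of_ι_comp (ξ := δ) (ξ' := ξ) (c := 𝟙 _)
    (Category.comp_id _)
  have ht : ξ.ι ≫ d = κ.π ≫ t := ha ▸ a.mid_π
  have hq : d ≫ q = ξ.π := by rw [← b.mid_π, hb, Category.id_comp]
  have htq : t ≫ q = 0 := by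
    rw [← cancel_epi κ.π, ← reassoc_of% ht, hq, ξ.zero, comp_zero]
  obtain ⟨σ, hσ⟩ := ξ.conflation.exists_desc (d - ρ ≫ t) (by
    rw [Preadditive.comp_sub, ht, reassoc_of% hρ, sub_self])
  have hσq : σ ≫ q = 𝟙 Y := by
    rw [← cancel_epi ξ.π, reassoc_of% hσ, Preadditive.sub_comp, hq, Category.assoc, htq,
      comp_zero, sub_zero, Category.comp_id]
  obtain ⟨ζ, c, -⟩ := δ.exists_isPullback σ
  exact ⟨ζ, ⟨c.comp b (hg := hσq)⟩⟩

end Extension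

open Extension

section ExtOrthogonal

variable {X X' Y Z L P I₀ I₁ J₀ J₁ : A} {i : I₀ ⟶ I₁} {j : J₀ ⟶ J₁}

lemma extOrthogonal_iff_exists_ι_comp_eq :
    E.ExtOrthogonal j i ↔ ∀ (ζ : E.Extension J₀ I₀) (ξ : E.Extension J₁ I₀),
      Hom ζ ξ (𝟙 I₀) j → ∃ h : ζ.obj ⟶ I₁, ζ.ι ≫ h = i := by
  rw [extOrthogonal_iff_factor_left]
  constructor
  · intro H ζ ξ u
    exact H _ _ _ _ _ _ ζ.zero ξ.zero u.mid ζ.conflation ξ.conflation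
      (by rw [u.ι_mid, Category.id_comp]) u.mid_π
  · intro H A₀ B m₀ e₀ m e w₀ w a h₀ h hm he
    exact H ⟨A₀, m₀, e₀, w₀, h₀⟩ ⟨B, m, e, w, h⟩ ⟨a, by rw [hm, Category.id_comp], he⟩

lemma extOrthogonal_iff_exists_comp_π_eq :
    E.ExtOrthogonal j i ↔ ∀ (ξ : E.Extension J₁ I₀) (ζ : E.Extension J₁ I₁),
      Hom ξ ζ i (𝟙 J₁) → ∃ g : J₀ ⟶ ζ.obj, g ≫ ζ.π = j := by
  rw [extOrthogonal_iff_factor_right]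
  constructor
  · intro H ξ ζ u
    exact H _ _ _ _ _ _ ζ.zero ξ.zero u.mid ζ.conflation ξ.conflation
      u.ι_mid (by rw [u.mid_π, Category.comp_id])
  · intro H A₁ B m₁ e₁ m e w₁ w a h₁ h hm he
    exact H ⟨B, m, e, w, h⟩ ⟨A₁, m₁, e₁, w₁, h₁⟩ ⟨a, hm, by rw [he, Category.comp_id]⟩

/-- The ideal of the morphisms `a` with `Ext(a, x) = 0`, for a single morphism `x`. -/
def leftOrthogonal (E : ExactStructure A) (x : X ⟶ X') : MorphismIdeal A where
  hom Y Z :=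
    { carrier := {a | E.ExtOrthogonal a x}
      zero_mem' := extOrthogonal_iff_exists_comp_π_eq.2 fun _ _ _ => ⟨0, zero_comp⟩
      add_mem' := fun {a b} ha hb => extOrthogonal_iff_exists_comp_π_eq.2 fun ξ ζ u => by
        obtain ⟨s, hs⟩ := extOrthogonal_iff_exists_comp_π_eq.1 ha ξ ζ u
        obtain ⟨t, ht⟩ := extOrthogonal_iff_exists_comp_π_eq.1 hb ξ ζ u
        exact ⟨s + t, by rw [Preadditive.add_comp, hs, ht]⟩
      neg_mem' := fun {a} ha => extOrthogonal_iff_exists_comp_π_eq.2 fun ξ ζ u => by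
        obtain ⟨s, hs⟩ := extOrthogonal_iff_exists_comp_π_eq.1 ha ξ ζ u
        exact ⟨-s, by rw [Preadditive.neg_comp, hs]⟩ }
  precomp_mem r _ ha := extOrthogonal_iff_exists_comp_π_eq.2 fun ξ ζ u => by
    obtain ⟨s, hs⟩ := extOrthogonal_iff_exists_comp_π_eq.1 ha ξ ζ u
    exact ⟨r ≫ s, by rw [Category.assoc, hs]⟩
  postcomp_mem r ha := ha.postcomp_left r

/-- The Ghost Lemma for single morphisms: the obstruction to `Ext(j ≫ i, s ≫ φ) = 0` dies in
`Ext(Y, P)` because of `i`, so it comes from `Ext(Y, L)`, where `j` kills it. -/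
lemma ExtOrthogonal.comp (κ : E.Extension P L) {s : X ⟶ κ.obj} {φ : κ.obj ⟶ X'} {j : J₀ ⟶ Y}
    {i : Y ⟶ Z} (hj : E.ExtOrthogonal j (κ.ι ≫ φ)) (hi : E.ExtOrthogonal i (s ≫ κ.π)) :
    E.ExtOrthogonal (j ≫ i) (s ≫ φ) := by
  refine extOrthogonal_iff_exists_ι_comp_eq.2 fun ζ ξ v => ?_
  obtain ⟨ξ₁, u₁, hu₁⟩ := ξ.exists_isPullback i
  obtain ⟨ξ₂, u₂, hu₂⟩ := ξ₁.exists_isPushout s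
  obtain ⟨ξ₃, u₃, -⟩ := ξ₂.exists_isPushout φ
  obtain ⟨k, hk⟩ := extOrthogonal_iff_exists_ι_comp_eq.1 hi ξ₁ ξ u₁
  obtain ⟨η, ⟨w⟩⟩ := exists_hom_of_ι_comp_eq_π κ ξ₂ (hu₂.inr_desc k κ.π hk)
  have hg : ∃ g : J₀ ⟶ ξ₃.obj, g ≫ ξ₃.π = j :=
    extOrthogonal_iff_exists_comp_π_eq.1 hj η ξ₃ (w.comp u₃)
  have a : Hom ζ ξ₁ (𝟙 X) j := v.lift u₁ hu₁
  have b : Hom ζ ξ₂ s j := a.comp u₂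
  have c : Hom ζ ξ₃ (s ≫ φ) j := b.comp u₃
  exact c.exists_ι_comp_eq_iff_exists_comp_π_eq.2 hg

end ExtOrthogonal

section ExtIdeal

variable {I J : MorphismIdeal A} {L P X X' : A}

lemma comp_mem_extIdeal (κ : E.Extension P L) {s : X ⟶ κ.obj} {φ : κ.obj ⟶ X'}
    (hφ : κ.ι ≫ φ ∈ I.hom L X') (hs : s ≫ κ.π ∈ J.hom X P) :
    s ≫ φ ∈ (E.extIdeal I J).hom X X' := by
  obtain ⟨κ₀, u₀, hu₀⟩ := κ.exists_isPullback (s ≫ κ.π)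
  obtain ⟨κ₁, u₁, hu₁⟩ := κ.exists_isPushout (κ.ι ≫ φ)
  have hmem : u₀.mid ≫ u₁.mid ∈ (E.extIdeal I J).hom κ₀.obj κ₁.obj :=
    MorphismIdeal.le_toProperty_span _ _ ⟨_, _, _, _, κ.ι ≫ φ, s ≫ κ.π, hφ, hs,
      ⟨⟨κ₀.ι, κ₀.π, κ₁.ι, κ₁.π, κ.obj, κ.ι, κ.π, u₀.mid, u₁.mid, κ₀.zero, κ₁.zero, κ.zero,
        κ₀.conflation, κ₁.conflation, κ.conflation, by rw [u₀.ι_mid, Category.id_comp], u₀.mid_π,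
        u₁.ι_mid, by rw [u₁.mid_π, Category.comp_id], rfl⟩⟩⟩
  have hl : 𝟙 X ≫ s ≫ κ.π = s ≫ κ.π := Category.id_comp _
  have hr : κ.ι ≫ φ = (κ.ι ≫ φ) ≫ 𝟙 X' := (Category.comp_id _).symm
  have hsφ : s ≫ φ = hu₀.lift (𝟙 X) s hl ≫ (u₀.mid ≫ u₁.mid) ≫ hu₁.desc φ (𝟙 X') hr := by
    rw [Category.assoc, hu₁.inl_desc, reassoc_of% hu₀.lift_snd (𝟙 X) s hl]
  rw [hsφ]
  exact (E.extIdeal I J).precomp_mem _ ((E.extIdeal I J).postcomp_mem _ hmem)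

/-- The pullback of `η` along `ζ.π` carries two morphisms to `θ`; their difference factors through
`θ.ι`. -/
lemma mem_extIdeal_of_hom {C Z : A} {ζ : E.Extension C X} {η : E.Extension C L}
    {θ : E.Extension Z X'} {f : X ⟶ X'} {k : L ⟶ X'} {i : C ⟶ Z} (u : Hom ζ θ f i)
    (v : Hom η θ k i) (hk : k ∈ I.hom L X') (hζ : ζ.ι ∈ J.hom X ζ.obj) :
    f ∈ (E.extIdeal I J).hom X X' := by
  obtain ⟨ω, w, hw⟩ := η.exists_isPullback ζ.π
  obtain ⟨φ, hφ⟩ := θ.conflation.exists_lift (ω.π ≫ u.mid - w.mid ≫ v.mid) (by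
    rw [Preadditive.sub_comp, Category.assoc, u.mid_π, Category.assoc, v.mid_π,
      reassoc_of% w.mid_π, sub_self])
  have hs : ζ.ι ≫ ζ.π = 0 ≫ η.π := by rw [ζ.zero, zero_comp]
  have hsφ : hw.lift ζ.ι 0 hs ≫ φ = f := by
    rw [← cancel_mono θ.ι, Category.assoc, hφ, Preadditive.comp_sub,
      reassoc_of% hw.lift_fst ζ.ι 0 hs, reassoc_of% hw.lift_snd ζ.ι 0 hs, zero_comp, sub_zero,
      u.ι_mid]
  have hωφ : ω.ι ≫ φ = -k := by
    rw [← cancel_mono θ.ι, Category.assoc, hφ, Preadditive.comp_sub, reassoc_of% ω.zero,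
      zero_comp, zero_sub, reassoc_of% w.ι_mid, v.ι_mid, Preadditive.neg_comp]
  rw [← hsφ]
  refine comp_mem_extIdeal ω ?_ ?_
  · rw [hωφ]
    exact neg_mem hk
  · rwa [hw.lift_fst]

lemma extIdeal_rightPerp_le_rightPerp_mul :
    E.extIdeal (E.rightPerp J) (E.rightPerp I) ≤ E.rightPerp (I * J) := by
  refine MorphismIdeal.span_le.2 ?_
  rintro X X' x ⟨_, _, _, _, k, l, hk, hl, ⟨ξ⟩⟩
  suffices I * J ≤ E.leftOrthogonal x from fun _ _ a ha => this _ ha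
  refine MorphismIdeal.span_le.2 ?_
  rintro _ _ _ ⟨_, j, i, hj, hi, rfl⟩
  change E.ExtOrthogonal (j ≫ i) x
  rw [← ξ.a₁_a₂]
  refine ExtOrthogonal.comp ⟨ξ.B, ξ.m, ξ.e, ξ.zero, ξ.conflation⟩ ?_ ?_
  · rw [ξ.m_a₂]
    exact (E.rightPerp J).postcomp_mem _ hk _ _ j hj
  · rw [ξ.a₁_e]
    exact (E.rightPerp I).precomp_mem _ hl _ _ i hi

/-- By the third isomorphism theorem the kernel `M₁` of `η₁.π ≫ ξ.π` is an extension of `K` by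
`L₁`; the one obtained from `η₀` in place of `η₁` carries the factorization of `κ`. -/
lemma mem_extIdeal_of_comp_mid {X K L₀ L₁ M₀ M₁ : A} {ξ : E.Extension X K}
    {η₀ : E.Extension ξ.obj L₀} {η₁ : E.Extension ξ.obj L₁} {l : L₀ ⟶ L₁}
    (v : Hom η₀ η₁ l (𝟙 ξ.obj)) (hl : l ∈ I.hom L₀ L₁) {μ₁ : M₁ ⟶ η₁.obj}
    {w₁ : μ₁ ≫ η₁.π ≫ ξ.π = 0} (h₁ : E.Conflation (ShortComplex.mk μ₁ (η₁.π ≫ ξ.π) w₁))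
    {κ : M₀ ⟶ M₁} {t : M₀ ⟶ η₀.obj} {g : M₀ ⟶ K} (hκ : κ ≫ μ₁ = t ≫ v.mid)
    (ht : t ≫ η₀.π = g ≫ ξ.ι) (hg : g ∈ J.hom M₀ K) : κ ∈ (E.extIdeal I J).hom M₀ M₁ := by
  have := h₁.mono
  have hv : v.mid ≫ η₁.π = η₀.π := by rw [v.mid_π, Category.comp_id]
  obtain ⟨ν, b, hb⟩ := η₀.exists_isPullback ξ.ι
  obtain ⟨φ, hφ⟩ := h₁.exists_lift (b.mid ≫ v.mid) (by
    rw [Category.assoc, reassoc_of% hv, reassoc_of% b.mid_π, ξ.zero, comp_zero])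
  obtain ⟨r, hr⟩ := h₁.exists_lift η₁.ι (by rw [reassoc_of% η₁.zero, zero_comp])
  have hκφ : hb.lift g t ht.symm ≫ φ = κ := by
    rw [← cancel_mono μ₁, Category.assoc, hφ, reassoc_of% hb.lift_snd g t ht.symm, hκ]
  have hνφ : ν.ι ≫ φ = l ≫ r := by
    rw [← cancel_mono μ₁, Category.assoc, hφ, reassoc_of% b.ι_mid, v.ι_mid, Category.assoc, hr]
  rw [← hκφ]
  refine comp_mem_extIdeal ν ?_ ?_
  · rw [hνφ]
    exact I.postcomp_mem r hl
  · rwa [hb.lift_fst]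

end ExtIdeal

section SpecialPrecovering

variable {I J : MorphismIdeal A}

lemma le_leftPerp_rightPerp (E : ExactStructure A) (I : MorphismIdeal A) :
    I ≤ E.leftPerp (E.rightPerp I) :=
  fun _ _ f hf _ _ _ hj => hj _ _ f hf

lemma isSpecialPrecovering_iff_exists_hom : E.IsSpecialPrecovering I ↔
    ∀ X : A, ∃ (K₀ K₁ : A) (k : K₀ ⟶ K₁) (ξ₀ : E.Extension X K₀) (ξ₁ : E.Extension X K₁)
      (_ : Hom ξ₀ ξ₁ k (𝟙 X)), k ∈ (E.rightPerp I).hom K₀ K₁ ∧ ξ₁.π ∈ I.hom ξ₁.obj X := by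
  refine forall_congr' fun X => ⟨?_, ?_⟩
  · rintro ⟨C₁, i₁, hi₁, K₀, K₁, C₀, k, c, m₀, i₀, m₁, w₀, w₁, h₀, h₁, hp, hc, hk⟩
    exact ⟨K₀, K₁, k, ⟨C₀, m₀, i₀, w₀, h₀⟩, ⟨C₁, m₁, i₁, w₁, h₁⟩,
      ⟨c, hp.w, by rw [hc, Category.comp_id]⟩, hk, hi₁⟩
  · rintro ⟨K₀, K₁, k, ξ₀, ξ₁, u, hk, hi⟩
    obtain ⟨ξ, v, hv⟩ := ξ₀.exists_isPushout k
    have hξ : hv.desc u.mid ξ₁.ι u.ι_mid ≫ ξ₁.π = ξ.π := hv.hom_ext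
      (by rw [← Category.assoc, hv.inl_desc, u.mid_π, v.mid_π])
      (by rw [← Category.assoc, hv.inr_desc, ξ₁.zero, ξ.zero])
    exact ⟨ξ.obj, ξ.π, hξ ▸ I.precomp_mem _ hi, K₀, K₁, ξ₀.obj, k, v.mid, ξ₀.ι, ξ₀.π, ξ.ι, ξ₀.zero,
      ξ.zero, ξ₀.conflation, ξ.conflation, hv, by rw [v.mid_π, Category.comp_id], hk⟩

lemma exists_comp_π_eq_of_mem_leftPerp_rightPerp {K₀ K₁ X Y : A} {k : K₀ ⟶ K₁}
    {ξ₀ : E.Extension X K₀} {ξ₁ : E.Extension X K₁} (u : Hom ξ₀ ξ₁ k (𝟙 X))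
    (hk : k ∈ (E.rightPerp I).hom K₀ K₁) {f : Y ⟶ X}
    (hf : f ∈ (E.leftPerp (E.rightPerp I)).hom Y X) : ∃ s : Y ⟶ ξ₁.obj, s ≫ ξ₁.π = f :=
  extOrthogonal_iff_exists_comp_π_eq.1 (hf _ _ k hk) ξ₀ ξ₁ u

lemma IsSpecialPrecovering.leftPerp_rightPerp (hI : E.IsSpecialPrecovering I) :
    E.leftPerp (E.rightPerp I) = I := by
  refine le_antisymm (fun Y X f hf => ?_) (le_leftPerp_rightPerp E I)
  obtain ⟨_, _, k, ξ₀, ξ₁, u, hk, hi⟩ := isSpecialPrecovering_iff_exists_hom.1 hI X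
  obtain ⟨s, rfl⟩ := exists_comp_π_eq_of_mem_leftPerp_rightPerp u hk hf
  exact I.precomp_mem s hi

lemma IsInjectiveMorphism.exists_ι_comp_eq {X X' Z : A} {f : X ⟶ X'}
    (hf : E.IsInjectiveMorphism f) (ξ : E.Extension Z X) : ∃ h : ξ.obj ⟶ X', ξ.ι ≫ h = f :=
  extOrthogonal_iff_exists_ι_comp_eq.1 (hf _ _ (𝟙 Z) (AddSubgroup.mem_top _)) ξ ξ
    ⟨𝟙 _, by simp, by simp⟩

/-- This is Salce's Lemma. -/
lemma ι_mem_rightPerp_of_isPullback {X Z C : A} {i : C ⟶ Z} {ζ : E.Extension C X}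
    {ξ : E.Extension Z X} (hξ : E.IsInjectiveMorphism ξ.ι) (u : Hom ζ ξ (𝟙 X) i)
    (hu : IsPullback ζ.π u.mid i ξ.π)
    (hi : ∀ {Y : A} (f : Y ⟶ Z), f ∈ I.hom Y Z → ∃ s : Y ⟶ C, s ≫ i = f) :
    ζ.ι ∈ (E.rightPerp I).hom X ζ.obj := by
  intro W V a ha
  refine extOrthogonal_iff_exists_ι_comp_eq.2 fun η₀ η v => ?_
  obtain ⟨b, hb⟩ := hξ.exists_ι_comp_eq η
  obtain ⟨t, w, -⟩ := exists_hom_mid_eq_of_ι_comp (ξ' := ξ) (f := 𝟙 X) (hb.trans (by simp))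
  obtain ⟨s, hs⟩ := hi (a ≫ t) (I.postcomp_mem t ha)
  let c : Hom η₀ ζ (𝟙 X) s := (v.comp w (hg := hs.symm)).lift u hu
  exact ⟨c.mid, c.ι_mid.trans (Category.id_comp _)⟩

lemma IsSpecialPrecovering.exists_ι_mem_rightPerp (hinj : E.HasEnoughInjectiveMorphisms)
    (hI : E.IsSpecialPrecovering I) (X : A) :
    ∃ (Z C : A) (i : C ⟶ Z) (ζ : E.Extension C X) (ξ : E.Extension Z X) (u : Hom ζ ξ (𝟙 X) i),
      IsPullback ζ.π u.mid i ξ.π ∧ i ∈ I.hom C Z ∧ ζ.ι ∈ (E.rightPerp I).hom X ζ.obj := by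
  obtain ⟨Y, x, ⟨Z, y, wx, hx⟩, hxinj⟩ := hinj X
  obtain ⟨_, _, k, ξ₀, ξ₁, v, hk, hi⟩ := isSpecialPrecovering_iff_exists_hom.1 hI Z
  obtain ⟨ζ, u, hu⟩ := exists_isPullback ⟨Y, x, y, wx, hx⟩ ξ₁.π
  exact ⟨Z, ξ₁.obj, ξ₁.π, ζ, _, u, hu, hi, ι_mem_rightPerp_of_isPullback hxinj u hu
    fun f hf => exists_comp_π_eq_of_mem_leftPerp_rightPerp v hk (le_leftPerp_rightPerp E I f hf)⟩

lemma IsSpecialPrecovering.rightPerp (hinj : E.HasEnoughInjectiveMorphisms)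
    (hI : E.IsSpecialPrecovering I) : E.IsSpecialPreenveloping (E.rightPerp I) := by
  intro X
  obtain ⟨Z, C, i, ζ, ξ, u, hu, hi, hζ⟩ := hI.exists_ι_mem_rightPerp hinj X
  exact ⟨ζ.obj, ζ.ι, hζ, Z, C, ξ.obj, i, u.mid, ξ.ι, ξ.π, ζ.π, ξ.zero, ζ.zero, ξ.conflation,
    ζ.conflation, hu, by rw [u.ι_mid, Category.id_comp], le_leftPerp_rightPerp E I i hi⟩

lemma rightPerp_mul (hinj : E.HasEnoughInjectiveMorphisms) (hI : E.IsSpecialPrecovering I)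
    (hJ : E.IsSpecialPrecovering J) :
    E.rightPerp (I * J) = E.extIdeal (E.rightPerp J) (E.rightPerp I) := by
  refine le_antisymm (fun X X' f hf => ?_) extIdeal_rightPerp_le_rightPerp_mul
  obtain ⟨Z, C, i, ζ, ξ, u, -, hi, hζ⟩ := hI.exists_ι_mem_rightPerp hinj X
  obtain ⟨L₀, L₁, l, η₀, η₁, v, hl, hj⟩ := isSpecialPrecovering_iff_exists_hom.1 hJ C
  obtain ⟨θ, w, -⟩ := ξ.exists_isPushout f
  obtain ⟨t, ht⟩ := extOrthogonal_iff_exists_comp_π_eq.1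
    (hf _ _ (η₁.π ≫ i) (MorphismIdeal.comp_mem_mul hj hi)) ξ θ w
  obtain ⟨a, b, -⟩ := exists_hom_mid_eq_of_comp_π ht
  have c : Hom ζ θ f i := u.comp w
  have d : Hom η₀ θ (l ≫ a) i := v.comp b
  exact mem_extIdeal_of_hom c d ((E.rightPerp J).postcomp_mem a hl) hζ

lemma IsSpecialPrecovering.mul (hinj : E.HasEnoughInjectiveMorphisms)
    (hI : E.IsSpecialPrecovering I) (hJ : E.IsSpecialPrecovering J) :
    E.IsSpecialPrecovering (I * J) := by
  refine isSpecialPrecovering_iff_exists_hom.2 fun X => ?_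
  obtain ⟨K₀, K₁, k, ξ₀, ξ₁, u, hk, hi⟩ := isSpecialPrecovering_iff_exists_hom.1 hI X
  obtain ⟨L₀, L₁, l, η₀, η₁, v, hl, hj⟩ := isSpecialPrecovering_iff_exists_hom.1 hJ ξ₁.obj
  obtain ⟨θ, a, -⟩ := η₀.exists_isPullback u.mid
  obtain ⟨M₀, μ₀, w₀, h₀⟩ := E.deflation_comp θ.π ξ₀.π ⟨_, _, _, θ.conflation⟩
    ⟨_, _, _, ξ₀.conflation⟩
  obtain ⟨M₁, μ₁, w₁, h₁⟩ := E.deflation_comp η₁.π ξ₁.π ⟨_, _, _, η₁.conflation⟩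
    ⟨_, _, _, ξ₁.conflation⟩
  have hmid : (a.mid ≫ v.mid) ≫ η₁.π ≫ ξ₁.π = (θ.π ≫ ξ₀.π) ≫ 𝟙 X := by
    rw [Category.assoc, reassoc_of% v.mid_π, reassoc_of% a.mid_π, u.mid_π, Category.assoc]
  obtain ⟨κ, c, hc⟩ := exists_hom_mid_eq_of_comp_π (ξ := ⟨_, μ₀, _, w₀, h₀⟩)
    (ξ' := ⟨_, μ₁, _, w₁, h₁⟩) hmid
  obtain ⟨r, hr⟩ := ξ₀.conflation.exists_lift (μ₀ ≫ θ.π) (by rw [Category.assoc, w₀])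
  have hκ : κ ≫ μ₁ = (μ₀ ≫ a.mid) ≫ v.mid := by rw [← c.ι_mid, hc, Category.assoc]
  have ht : (μ₀ ≫ a.mid) ≫ η₀.π = (r ≫ k) ≫ ξ₁.ι := by
    rw [Category.assoc, a.mid_π, ← reassoc_of% hr, u.ι_mid, Category.assoc]
  refine ⟨M₀, M₁, κ, _, _, c, ?_, MorphismIdeal.comp_mem_mul hj hi⟩
  rw [rightPerp_mul hinj hI hJ]
  exact mem_extIdeal_of_comp_mid v hl h₁ hκ ht ((E.rightPerp I).precomp_mem r hk)

end SpecialPrecovering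

end ExactStructure

section Opposite

variable {A : Type u} [Category.{v} A] [Preadditive A]

namespace MorphismIdeal

/-- The ideal `I`, regarded as an ideal of the opposite category. -/
def op (I : MorphismIdeal A) : MorphismIdeal Aᵒᵖ where
  hom X Y := (I.hom Y.unop X.unop).comap (unopHom X Y)
  precomp_mem s _ hf := I.postcomp_mem s.unop hf
  postcomp_mem r hf := I.precomp_mem r.unop hf

/-- The ideal of `A` that corresponds to an ideal of the opposite category. -/
def unop (I : MorphismIdeal Aᵒᵖ) : MorphismIdeal A where
  hom X Y := (I.hom (Opposite.op Y) (Opposite.op X)).comap (opHom X Y)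
  precomp_mem s _ hf := I.postcomp_mem s.op hf
  postcomp_mem r hf := I.precomp_mem r.op hf

lemma op_injective : Function.Injective (op (A := A)) :=
  Function.LeftInverse.injective (g := unop) fun _ => rfl

lemma op_span (M : MorphismProperty A) : (span M).op = span M.op := by
  refine le_antisymm (fun X Y f hf => ?_) (span_le.2 fun X Y f hf => ?_)
  · have hM : span M ≤ (span M.op).unop := span_le.2 fun _ _ g hg => le_toProperty_span M.op g.op hg
    exact hM f.unop hf
  · exact le_toProperty_span M f.unop hf

lemma op_mul (I J : MorphismIdeal A) : (I * J).op = J.op * I.op := by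
  refine (op_span _).trans (congrArg span ?_)
  ext X Z f
  constructor
  · rintro ⟨Y, j, i, hj, hi, hf⟩
    exact ⟨Opposite.op Y, i.op, j.op, hi, hj, congrArg Quiver.Hom.op hf⟩
  · rintro ⟨Y, i, j, hi, hj, rfl⟩
    exact ⟨Y.unop, j.unop, i.unop, hj, hi, rfl⟩

end MorphismIdeal

namespace ExactStructure

/-- The opposite exact structure: its inflations are the deflations of `E`, and conversely. -/
def op (E : ExactStructure A) : ExactStructure Aᵒᵖ where
  Conflation S := E.Conflation S.unop
  isKernelCokernelPair {S} hS := by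
    obtain ⟨⟨l⟩, ⟨r⟩⟩ := E.isKernelCokernelPair hS
    exact ⟨⟨CokernelCofork.IsColimit.ofπOp _ _ r⟩, ⟨KernelFork.IsLimit.ofιOp _ _ l⟩⟩
  of_iso e h := E.of_iso ((ShortComplex.unopFunctor A).mapIso e).unop.symm h
  inflation_id X := by
    obtain ⟨Y, m, w, h⟩ := E.deflation_id X.unop
    exact ⟨Opposite.op Y, m.op, congrArg Quiver.Hom.op w, h⟩
  deflation_id X := by
    obtain ⟨Y, e, w, h⟩ := E.inflation_id X.unop
    exact ⟨Opposite.op Y, e.op, congrArg Quiver.Hom.op w, h⟩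
  inflation_comp := by
    rintro _ _ _ m n ⟨P, d, w, h⟩ ⟨Q, e, w', h'⟩
    obtain ⟨R, r, w'', h''⟩ := E.deflation_comp n.unop m.unop
      ⟨_, e.unop, congrArg Quiver.Hom.unop w', h'⟩ ⟨_, d.unop, congrArg Quiver.Hom.unop w, h⟩
    exact ⟨Opposite.op R, r.op, congrArg Quiver.Hom.op w'', h''⟩
  deflation_comp := by
    rintro _ _ _ d e ⟨P, m, w, h⟩ ⟨Q, n, w', h'⟩
    obtain ⟨R, r, w'', h''⟩ := E.inflation_comp e.unop d.unop
      ⟨_, n.unop, congrArg Quiver.Hom.unop w', h'⟩ ⟨_, m.unop, congrArg Quiver.Hom.unop w, h⟩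
    exact ⟨Opposite.op R, r.op, congrArg Quiver.Hom.op w'', h''⟩
  inflation_pushout := by
    rintro _ _ _ m s ⟨P, d, w, h⟩
    obtain ⟨Y, e, c, hp, Q, n, w', h'⟩ := E.deflation_pullback m.unop s.unop
      ⟨_, d.unop, congrArg Quiver.Hom.unop w, h⟩
    exact ⟨Opposite.op Y, c.op, e.op, hp.op, Opposite.op Q, n.op, congrArg Quiver.Hom.op w', h'⟩
  deflation_pullback := by
    rintro _ _ _ e t ⟨P, m, w, h⟩
    obtain ⟨Y, c, n, hp, Q, d, w', h'⟩ := E.inflation_pushout e.unop t.unop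
      ⟨_, m.unop, congrArg Quiver.Hom.unop w, h⟩
    exact ⟨Opposite.op Y, n.op, c.op, hp.op, Opposite.op Q, d.op, congrArg Quiver.Hom.op w', h'⟩

variable {E : ExactStructure A}

/-- The dual of an ME-conflation, with the roles of the left and right ends interchanged. -/
def MEConflation.op {I₀ I₁ A₀ A₁ J₀ J₁ : A} {i : I₀ ⟶ I₁} {a : A₀ ⟶ A₁} {j : J₀ ⟶ J₁}
    (ξ : E.MEConflation i a j) : E.op.MEConflation j.op a.op i.op where
  m₀ := ξ.e₁.op
  e₀ := ξ.m₁.op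
  m₁ := ξ.e₀.op
  e₁ := ξ.m₀.op
  B := Opposite.op ξ.B
  m := ξ.e.op
  e := ξ.m.op
  a₁ := ξ.a₂.op
  a₂ := ξ.a₁.op
  zero₀ := congrArg Quiver.Hom.op ξ.zero₁
  zero₁ := congrArg Quiver.Hom.op ξ.zero₀
  zero := congrArg Quiver.Hom.op ξ.zero
  conflation₀ := ξ.conflation₁
  conflation₁ := ξ.conflation₀
  conflation := ξ.conflation
  m₀_a₁ := congrArg Quiver.Hom.op ξ.a₂_e₁
  a₁_e := congrArg Quiver.Hom.op ξ.m_a₂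
  m_a₂ := congrArg Quiver.Hom.op ξ.a₁_e
  a₂_e₁ := congrArg Quiver.Hom.op ξ.m₀_a₁
  a₁_a₂ := congrArg Quiver.Hom.op ξ.a₁_a₂

/-- The ME-conflation of `A` that corresponds to one of the opposite category. -/
def MEConflation.unop {I₀ I₁ A₀ A₁ J₀ J₁ : Aᵒᵖ} {i : I₀ ⟶ I₁} {a : A₀ ⟶ A₁} {j : J₀ ⟶ J₁}
    (ξ : E.op.MEConflation i a j) : E.MEConflation j.unop a.unop i.unop where
  m₀ := ξ.e₁.unop
  e₀ := ξ.m₁.unop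
  m₁ := ξ.e₀.unop
  e₁ := ξ.m₀.unop
  B := ξ.B.unop
  m := ξ.e.unop
  e := ξ.m.unop
  a₁ := ξ.a₂.unop
  a₂ := ξ.a₁.unop
  zero₀ := congrArg Quiver.Hom.unop ξ.zero₁
  zero₁ := congrArg Quiver.Hom.unop ξ.zero₀
  zero := congrArg Quiver.Hom.unop ξ.zero
  conflation₀ := ξ.conflation₁
  conflation₁ := ξ.conflation₀
  conflation := ξ.conflation
  m₀_a₁ := congrArg Quiver.Hom.unop ξ.a₂_e₁
  a₁_e := congrArg Quiver.Hom.unop ξ.m_a₂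
  m_a₂ := congrArg Quiver.Hom.unop ξ.a₁_e
  a₂_e₁ := congrArg Quiver.Hom.unop ξ.m₀_a₁
  a₁_a₂ := congrArg Quiver.Hom.unop ξ.a₁_a₂

lemma extOrthogonal_op {J₀ J₁ I₀ I₁ : Aᵒᵖ} {j : J₀ ⟶ J₁} {i : I₀ ⟶ I₁} :
    E.op.ExtOrthogonal j i ↔ E.ExtOrthogonal i.unop j.unop := by
  constructor
  · intro H A₀ A₁ a ξ
    obtain ⟨h, g, ha⟩ := H _ _ a.op ξ.op
    exact ⟨g.unop, h.unop, (congrArg Quiver.Hom.unop ha).trans (add_comm _ _)⟩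
  · intro H A₀ A₁ a ξ
    obtain ⟨h, g, ha⟩ := H _ _ a.unop ξ.unop
    exact ⟨g.op, h.op, (congrArg Quiver.Hom.op ha).trans (add_comm _ _)⟩

lemma rightPerp_op (J : MorphismIdeal A) : E.op.rightPerp J.op = (E.leftPerp J).op := by
  ext X Y f
  exact ⟨fun H _ _ j hj => extOrthogonal_op.1 (H _ _ j.op hj),
    fun H _ _ j hj => extOrthogonal_op.2 (H _ _ j.unop hj)⟩

lemma leftPerp_op (I : MorphismIdeal A) : E.op.leftPerp I.op = (E.rightPerp I).op := by
  ext X Y f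
  exact ⟨fun H _ _ i hi => extOrthogonal_op.1 (H _ _ i.op hi),
    fun H _ _ i hi => extOrthogonal_op.2 (H _ _ i.unop hi)⟩

lemma op_extIdeal (I J : MorphismIdeal A) :
    (E.extIdeal I J).op = E.op.extIdeal J.op I.op := by
  refine (MorphismIdeal.op_span _).trans (congrArg MorphismIdeal.span ?_)
  ext X Y a
  constructor
  · rintro ⟨_, _, _, _, i, j, hi, hj, ⟨ξ⟩⟩
    exact ⟨_, _, _, _, j.op, i.op, hj, hi, ⟨ξ.op⟩⟩
  · rintro ⟨_, _, _, _, j, i, hj, hi, ⟨ξ⟩⟩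
    exact ⟨_, _, _, _, i.unop, j.unop, hi, hj, ⟨ξ.unop⟩⟩

lemma isSpecialPrecovering_op {J : MorphismIdeal A} :
    E.op.IsSpecialPrecovering J.op ↔ E.IsSpecialPreenveloping J := by
  simp only [IsSpecialPrecovering, IsSpecialPrecover, rightPerp_op]
  constructor
  · intro H X
    obtain ⟨C, i, hi, K₀, K₁, C₀, k, c, m₀, i₀, m₁, w₀, w₁, h₀, h₁, hp, hc, hk⟩ :=
      H (Opposite.op X)
    exact ⟨C.unop, i.unop, hi, K₀.unop, K₁.unop, C₀.unop, k.unop, c.unop, i₀.unop, m₀.unop,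
      m₁.unop, congrArg Quiver.Hom.unop w₀, congrArg Quiver.Hom.unop w₁, h₀, h₁, hp.unop,
      congrArg Quiver.Hom.unop hc, hk⟩
  · intro H X
    obtain ⟨C, j, hj, K₀, K₁, C₀, k, c, j₀, e₀, e₁, w₀, w₁, h₀, h₁, hp, hc, hk⟩ := H X.unop
    exact ⟨Opposite.op C, j.op, hj, Opposite.op K₀, Opposite.op K₁, Opposite.op C₀, k.op, c.op,
      e₀.op, j₀.op, e₁.op, congrArg Quiver.Hom.op w₀, congrArg Quiver.Hom.op w₁, h₀, h₁, hp.op,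
      congrArg Quiver.Hom.op hc, hk⟩

lemma isSpecialPreenveloping_op {I : MorphismIdeal A} :
    E.op.IsSpecialPreenveloping I.op ↔ E.IsSpecialPrecovering I := by
  simp only [IsSpecialPreenveloping, IsSpecialPreenvelope, leftPerp_op]
  constructor
  · intro H X
    obtain ⟨C, j, hj, K₀, K₁, C₀, k, c, j₀, e₀, e₁, w₀, w₁, h₀, h₁, hp, hc, hk⟩ :=
      H (Opposite.op X)
    exact ⟨C.unop, j.unop, hj, K₀.unop, K₁.unop, C₀.unop, k.unop, c.unop, e₀.unop, j₀.unop,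
      e₁.unop, congrArg Quiver.Hom.unop w₀, congrArg Quiver.Hom.unop w₁, h₀, h₁, hp.unop,
      congrArg Quiver.Hom.unop hc, hk⟩
  · intro H X
    obtain ⟨C, i, hi, K₀, K₁, C₀, k, c, m₀, i₀, m₁, w₀, w₁, h₀, h₁, hp, hc, hk⟩ := H X.unop
    exact ⟨Opposite.op C, i.op, hi, Opposite.op K₀, Opposite.op K₁, Opposite.op C₀, k.op, c.op,
      i₀.op, m₀.op, m₁.op, congrArg Quiver.Hom.op w₀, congrArg Quiver.Hom.op w₁, h₀, h₁, hp.op,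
      congrArg Quiver.Hom.op hc, hk⟩

lemma HasEnoughProjectiveMorphisms.op (hproj : E.HasEnoughProjectiveMorphisms) :
    E.op.HasEnoughInjectiveMorphisms := by
  intro X
  obtain ⟨Y, p, ⟨Z, m, w, h⟩, hp⟩ := hproj X.unop
  exact ⟨Opposite.op Y, p.op, ⟨Opposite.op Z, m.op, congrArg Quiver.Hom.op w, h⟩,
    fun _ _ i _ => extOrthogonal_op.2 (hp _ _ i.unop (AddSubgroup.mem_top _))⟩

end ExactStructure

end Opposite

namespace ExactStructure

variable {A : Type u} [Category.{v} A] [Preadditive A] {E : ExactStructure A}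
  {I J K L : MorphismIdeal A}

section SpecialPreenveloping

lemma IsSpecialPreenveloping.rightPerp_leftPerp (hK : E.IsSpecialPreenveloping K) :
    E.rightPerp (E.leftPerp K) = K :=
  MorphismIdeal.op_injective <| by
    rw [← leftPerp_op, ← rightPerp_op, (isSpecialPrecovering_op.2 hK).leftPerp_rightPerp]

lemma IsSpecialPreenveloping.leftPerp (hproj : E.HasEnoughProjectiveMorphisms)
    (hK : E.IsSpecialPreenveloping K) : E.IsSpecialPrecovering (E.leftPerp K) := by
  rw [← isSpecialPreenveloping_op, ← rightPerp_op]
  exact (isSpecialPrecovering_op.2 hK).rightPerp hproj.op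

lemma leftPerp_mul (hproj : E.HasEnoughProjectiveMorphisms) (hK : E.IsSpecialPreenveloping K)
    (hL : E.IsSpecialPreenveloping L) :
    E.leftPerp (K * L) = E.extIdeal (E.leftPerp L) (E.leftPerp K) :=
  MorphismIdeal.op_injective <| by
    rw [← rightPerp_op, MorphismIdeal.op_mul, op_extIdeal, ← rightPerp_op, ← rightPerp_op,
      rightPerp_mul hproj.op (isSpecialPrecovering_op.2 hL) (isSpecialPrecovering_op.2 hK)]

lemma IsSpecialPreenveloping.mul (hproj : E.HasEnoughProjectiveMorphisms)
    (hK : E.IsSpecialPreenveloping K) (hL : E.IsSpecialPreenveloping L) :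
    E.IsSpecialPreenveloping (K * L) := by
  rw [← isSpecialPrecovering_op, MorphismIdeal.op_mul]
  exact (isSpecialPrecovering_op.2 hL).mul hproj.op (isSpecialPrecovering_op.2 hK)

end SpecialPreenveloping

section GhostLemma

variable (hinj : E.HasEnoughInjectiveMorphisms) (hproj : E.HasEnoughProjectiveMorphisms)
include hinj hproj

lemma bijOn_rightPerp :
    Set.BijOn E.rightPerp {I | E.IsSpecialPrecovering I} {K | E.IsSpecialPreenveloping K} :=
  Set.InvOn.bijOn (f' := E.leftPerp)
    ⟨fun _ hI => IsSpecialPrecovering.leftPerp_rightPerp hI,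
      fun _ hK => IsSpecialPreenveloping.rightPerp_leftPerp hK⟩
    (fun _ hI => IsSpecialPrecovering.rightPerp hinj hI)
    (fun _ hK => IsSpecialPreenveloping.leftPerp hproj hK)

lemma extIdeal_eq_leftPerp_mul (hI : E.IsSpecialPrecovering I) (hJ : E.IsSpecialPrecovering J) :
    E.extIdeal I J = E.leftPerp (E.rightPerp J * E.rightPerp I) := by
  rw [leftPerp_mul hproj (hJ.rightPerp hinj) (hI.rightPerp hinj), hI.leftPerp_rightPerp,
    hJ.leftPerp_rightPerp]

lemma IsSpecialPrecovering.extIdeal (hI : E.IsSpecialPrecovering I)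
    (hJ : E.IsSpecialPrecovering J) : E.IsSpecialPrecovering (E.extIdeal I J) := by
  rw [extIdeal_eq_leftPerp_mul hinj hproj hI hJ]
  exact ((hJ.rightPerp hinj).mul hproj (hI.rightPerp hinj)).leftPerp hproj

lemma rightPerp_extIdeal (hI : E.IsSpecialPrecovering I) (hJ : E.IsSpecialPrecovering J) :
    E.rightPerp (E.extIdeal I J) = E.rightPerp J * E.rightPerp I := by
  rw [extIdeal_eq_leftPerp_mul hinj hproj hI hJ]
  exact ((hJ.rightPerp hinj).mul hproj (hI.rightPerp hinj)).rightPerp_leftPerp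

lemma IsSpecialPreenveloping.extIdeal (hK : E.IsSpecialPreenveloping K)
    (hL : E.IsSpecialPreenveloping L) : E.IsSpecialPreenveloping (E.extIdeal K L) := by
  rw [← hK.rightPerp_leftPerp, ← hL.rightPerp_leftPerp,
    ← rightPerp_mul hinj (hL.leftPerp hproj) (hK.leftPerp hproj)]
  exact ((hL.leftPerp hproj).mul hinj (hK.leftPerp hproj)).rightPerp hinj

end GhostLemma

end ExactStructure

theorem mainTheorem8 {A : Type u} [Category.{v} A] [Preadditive A] [HasFiniteBiproducts A]
    (E : ExactStructure A)
    (hinj : E.HasEnoughInjectiveMorphisms) (hproj : E.HasEnoughProjectiveMorphisms) :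
    (∀ I J : MorphismIdeal A, E.IsSpecialPrecovering I → E.IsSpecialPrecovering J →
      E.IsSpecialPrecovering (I * J) ∧ E.IsSpecialPrecovering (E.extIdeal I J)) ∧
    (∀ I J : MorphismIdeal A, E.IsSpecialPreenveloping I → E.IsSpecialPreenveloping J →
      E.IsSpecialPreenveloping (I * J) ∧ E.IsSpecialPreenveloping (E.extIdeal I J)) ∧
    Set.BijOn E.rightPerp {I | E.IsSpecialPrecovering I} {K | E.IsSpecialPreenveloping K} ∧
    (∀ I J : MorphismIdeal A, E.IsSpecialPrecovering I → E.IsSpecialPrecovering J →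
      E.rightPerp (I * J) = E.extIdeal (E.rightPerp J) (E.rightPerp I) ∧
      E.rightPerp (E.extIdeal I J) = E.rightPerp J * E.rightPerp I) := by
  refine ⟨fun I J hI hJ => ⟨hI.mul hinj hJ, hI.extIdeal hinj hproj hJ⟩,
    fun I J hI hJ => ⟨hI.mul hproj hJ, hI.extIdeal hinj hproj hJ⟩,
    ExactStructure.bijOn_rightPerp hinj hproj,
    fun I J hI hJ => ⟨ExactStructure.rightPerp_mul hinj hI hJ,
      ExactStructure.rightPerp_extIdeal hinj hproj hI hJ⟩⟩
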